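/- **Theorem 4.1.** Let $p\ge 1$, $0<b<1$, $c>0$ and $0\le\varepsilon<\min\{b,1-b\}$. Let $\rho:\mathbb R\to\mathbb R$ satisfy A3: $\rho$ is symmetric, nondecreasing on $[0,\infty)$, $\rho(0)=0$; $\rho$ is bounded with $\lim_{u\to\infty}\rho(u)=1$; $\rho$ has only finitely many discontinuities. Put $g(s)=E\,\rho(Z/s)$ for $s>0$, where $Z\sim N(0,1)$, and assume $\rho(u)<(b-\varepsilon)/(1-\varepsilon)$ for some $u>0$ (this holds automatically if $\rho$ is continuous at $0$; it ensures that $(b-\varepsilon)/(1-\varepsilon)$ is a value of $g$). Let $(y,\mathbf x)\in\mathbb R\times\mathbb R^p$ have distribution $H_o=N(\mathbf 0,\mathbf I_{p+1})$ and let $V_\varepsilon=\{(1-\varepsilon)H_o+\varepsilon H^*: H^*\text{ a probability distribution on }\mathbb R^{p+1}\}$. For a distribution $H$, the CM problem is to minimize $$L_H(\alpha,\boldsymbol\theta,\sigma)=c\,E_H\,\rho\!\left(\frac{y-\alpha-\mathbf x'\boldsymbol\theta}{\sigma}\right)+\log\sigma$$ over $\alpha\in\mathbb R$, $\boldsymbol\theta\in\mathbb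 R^p$, $\sigma>0$ subject to $E_H\,\rho\big((y-\alpha-\mathbf x'\boldsymbol\theta)/\sigma\big)\le b$. A solution is a point $(\alpha,\boldsymbol\theta,\sigma)$, $\sigma>0$, that is the limit of a sequence of feasible points along which $L_H$ converges to its finite infimum over the feasible points; every constrained minimizer is a solution, and when $\rho$ is lower semicontinuous there are no others. Let $\mathcal H$ be the set of distributions $H$ at which a solution exists, and let $\mathbf T_{CM}$ be a CM-estimate of the slopes: for each $H\in\mathcal H$, $\mathbf T_{CM}(H)$ is the $\boldsymbol\theta$-component of some solution at $H$. Let $B_{CM}(\varepsilon)=\sup_{H\in V_\varepsilon} b(\mathbf T_{CM},H)\in[0,\infty]$ be its maximum bias, where $b(\mathbf T_{CM},H)=\|\mathbf T_{CM}(H)\|$ if $H\in\mathcal H$ and $b(\mathbf T_{CM},H)=\infty$ otherwise. Then $g$ is injective on $(0,\infty)$; the values $\sigma_{b,\varepsilon}=g^{-1}[(b-\varepsilon)/(1-\varepsilon)]$ and $\gamma_{b,\varepsilon}=g^{-1}[b/(1-\varepsilon)]$ in $(0,\infty)$ exist; with $$A_{c,\varepsilon}(s)=c(1-\varepsilon)g(s)+\log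 s,\qquad D_c(\varepsilon)=\inf_{s\ge\sigma_{b,\varepsilon}}A_{c,\varepsilon}(s)-\inf_{s\ge\gamma_{b,\varepsilon}}A_{c,\varepsilon}(s),$$ both infima are finite, $\exp[2c\varepsilon+2D_c(\varepsilon)]\ge 1$, and $$B_{CM}(\varepsilon)=\{\exp[2c\varepsilon+2D_c(\varepsilon)]-1\}^{1/2}.$$ -/

import Mathlib

open MeasureTheory ProbabilityTheory Filter Topology

noncomputable section

namespace CMRegression

/-- Observations `(y, x)`: the response `y ∈ ℝ` and the regressors `x ∈ ℝᵖ` (Euclidean norm). -/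
abbrev Obs (p : ℕ) : Type := ℝ × EuclideanSpace ℝ (Fin p)

/-- Parameters `(α, θ, σ)`: intercept, slopes and residual scale. -/
abbrev Param (p : ℕ) : Type := ℝ × EuclideanSpace ℝ (Fin p) × ℝ

/-- The conditions on the loss function `ρ`. -/
structure IsLoss (ρ : ℝ → ℝ) : Prop where
  symm : ∀ u, ρ (-u) = ρ u
  mono : MonotoneOn ρ (Set.Ici 0)
  zero : ρ 0 = 0
  bounded : ∃ M, ∀ u, |ρ u| ≤ M
  tendsto_one : Tendsto ρ atTop (𝓝 1)
  finite_discontinuities : {u : ℝ | ¬ ContinuousAt ρ u}.Finite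

/-- The Gaussian model: `(y, x)` has the joint `N(0, I_{p+1})` law. -/
def gaussianModel (p : ℕ) : Measure (Obs p) :=
  (gaussianReal 0 1).prod (stdGaussian (EuclideanSpace ℝ (Fin p)))

/-- The contamination neighbourhood
`V_ε = {(1 - ε) H₀ + ε H* : H* any probability distribution of (y, x)}`. -/
def contaminated {p : ℕ} (H₀ : Measure (Obs p)) (ε : ℝ) : Set (Measure (Obs p)) :=
  {H | ∃ Hs : Measure (Obs p), IsProbabilityMeasure Hs ∧
    H = ENNReal.ofReal (1 - ε) • H₀ + ENNReal.ofReal ε • Hs}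

/-- `E_H ρ((y - α - x'θ) / σ)`. -/
def meanLoss {p : ℕ} (ρ : ℝ → ℝ) (H : Measure (Obs p)) (q : Param p) : ℝ :=
  ∫ w, ρ ((w.1 - q.1 - inner ℝ w.2 q.2.1) / q.2.2) ∂H

/-- The constraint set: `σ > 0` and `E_H ρ((y - α - x'θ) / σ) ≤ b`. -/
def feasible {p : ℕ} (ρ : ℝ → ℝ) (b : ℝ) (H : Measure (Obs p)) : Set (Param p) :=
  {q | 0 < q.2.2 ∧ meanLoss ρ H q ≤ b}

/-- The CM objective `L_H(α, θ, σ) = c E_H ρ((y - α - x'θ) / σ) + log σ`. -/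
def objective {p : ℕ} (ρ : ℝ → ℝ) (c : ℝ) (H : Measure (Obs p)) (q : Param p) : ℝ :=
  c * meanLoss ρ H q + Real.log q.2.2

/-- `q = (α, θ, σ)` solves the CM problem at `H`: it is the limit of a minimizing sequence of
feasible points. Every constrained minimizer is a solution (constant sequences), and if `ρ` is lower
semicontinuous there are no others; for a loss such as `1{|u| ≥ 1}` the minimum need not be
attained, and the limiting solutions take the place of the minimizers. -/
def IsCMSolution {p : ℕ} (ρ : ℝ → ℝ) (b c : ℝ) (H : Measure (Obs p)) (q : Param p) : Prop :=
  0 < q.2.2 ∧ ∃ l : ℝ, IsGLB (objective ρ c H '' feasible ρ b H) l ∧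
    ∃ u : ℕ → Param p, (∀ n, u n ∈ feasible ρ b H) ∧ Tendsto u atTop (𝓝 q) ∧
      Tendsto (fun n => objective ρ c H (u n)) atTop (𝓝 l)

/-- The distributions at which the CM-estimate is defined: those at which the CM problem has a
solution. -/
def cmDomain (p : ℕ) (ρ : ℝ → ℝ) (b c : ℝ) : Set (Measure (Obs p)) :=
  {H | IsProbabilityMeasure H ∧ ∃ q, IsCMSolution ρ b c H q}

/-- `T` is (the slope part of) a CM-estimate: where the CM problem has solutions, `T(H)` is the
slope component of one of them, however chosen. -/
def IsCMEstimate {p : ℕ} (ρ : ℝ → ℝ) (b c : ℝ)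
    (T : Measure (Obs p) → EuclideanSpace ℝ (Fin p)) : Prop :=
  ∀ H ∈ cmDomain p ρ b c, ∃ α σ : ℝ, IsCMSolution ρ b c H (α, T H, σ)

open Classical in
/-- The bias of `T` at `H`: `‖T(H)‖` if `H` is in the domain `D` of `T`, and `∞` otherwise. -/
def bias {p : ℕ} (D : Set (Measure (Obs p))) (T : Measure (Obs p) → EuclideanSpace ℝ (Fin p))
    (H : Measure (Obs p)) : ENNReal :=
  if H ∈ D then ENNReal.ofReal ‖T H‖ else ⊤

/-- The maximum bias `B_T(ε) = sup {b(T, H) : H ∈ V_ε}`, with values in `[0, ∞]`. -/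
def maxBias {p : ℕ} (D : Set (Measure (Obs p)))
    (T : Measure (Obs p) → EuclideanSpace ℝ (Fin p)) (H₀ : Measure (Obs p)) (ε : ℝ) : ENNReal :=
  ⨆ H ∈ contaminated H₀ ε, bias D T H

/-- `g(s) = E ρ(Z / s)` for a standard normal `Z`. -/
def g (ρ : ℝ → ℝ) (s : ℝ) : ℝ := ∫ z, ρ (z / s) ∂(gaussianReal 0 1)

/-- The inverse of `g` on `(0, ∞)`. -/
def gInv (ρ : ℝ → ℝ) (v : ℝ) : ℝ := Function.invFunOn (g ρ) (Set.Ioi 0) v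

/-- `σ_{b,ε} = g⁻¹((b - ε) / (1 - ε))`. -/
def sigma (ρ : ℝ → ℝ) (b ε : ℝ) : ℝ := gInv ρ ((b - ε) / (1 - ε))

/-- `γ_{b,ε} = g⁻¹(b / (1 - ε))`. -/
def gamma (ρ : ℝ → ℝ) (b ε : ℝ) : ℝ := gInv ρ (b / (1 - ε))

/-- `A_{c,ε}(s) = c (1 - ε) g(s) + log s`. -/
def A (ρ : ℝ → ℝ) (c ε s : ℝ) : ℝ := c * (1 - ε) * g ρ s + Real.log s

/-- `D_c(ε) = inf_{s ≥ σ_{b,ε}} A_{c,ε}(s) - inf_{s ≥ γ_{b,ε}} A_{c,ε}(s)`. -/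
def D (ρ : ℝ → ℝ) (b c ε : ℝ) : ℝ :=
  sInf (A ρ c ε '' Set.Ici (sigma ρ b ε)) - sInf (A ρ c ε '' Set.Ici (gamma ρ b ε))

end CMRegression

end

/-! Put `τ = √(1 + ‖θ‖²)`. At the Gaussian model the residual `y - α - x'θ` is `N(-α, τ²)`, so by
Anderson's inequality its mean loss is at least `g(σ/τ)`, with equality for `α = 0`. With `s = σ/τ`,
the objective at `(1 - ε) H₀ + ε H*` is therefore at least `A(s) + log τ + c ε E_{H*} ρ`
(`Setting.le_objective`).

Upper bound: feasibility forces `s ≥ γ`, so the objective is at least `inf_{s ≥ γ} A + log τ`. Zero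
slopes with scale `s ≥ σ_{b,ε}` are feasible for every `H*` and cost at most `A(s) + c ε`.
Comparison gives `log τ ≤ c ε + D` at every solution (`Setting.log_slopeScale_le`).

Lower bound: let `H*` be a point mass at `(r β, r e)` with `‖e‖ = 1`. The slopes `β e` fit it
exactly, so the optimal value is at most `inf_{s ≥ γ} A + log √(1 + β²)`. For large `r`,
near-optimal points with slopes shorter than `β - δ` have contamination loss close to `1`, hence
cost nearly `inf_{s ≥ σ_{b,ε}} A + c ε`. This is too much when `log √(1 + β²) < c ε + D`
(`Setting.exists_contamination`).

Solutions exist throughout the neighbourhood by compactness (`Setting.exists_bounds`), so the bias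
is never infinite by default. -/

noncomputable section

namespace CMRegression

variable {ρ : ℝ → ℝ}

/-! ### Elementary properties of the loss -/

namespace IsLoss

lemma apply_abs (hρ : IsLoss ρ) (u : ℝ) : ρ |u| = ρ u := by
  rcases abs_choice u with h | h <;> rw [h]
  exact hρ.symm u

lemma le_of_abs_le (hρ : IsLoss ρ) {u v : ℝ} (h : |u| ≤ |v|) : ρ u ≤ ρ v := by
  rw [← hρ.apply_abs u, ← hρ.apply_abs v]
  exact hρ.mono (abs_nonneg u) (abs_nonneg v) h

lemma nonneg (hρ : IsLoss ρ) (u : ℝ) : 0 ≤ ρ u := by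
  rw [← hρ.zero]
  exact hρ.le_of_abs_le (by simp)

lemma le_one (hρ : IsLoss ρ) (u : ℝ) : ρ u ≤ 1 := by
  refine ge_of_tendsto hρ.tendsto_one ?_
  filter_upwards [eventually_ge_atTop |u|] with v hv
  exact hρ.le_of_abs_le (hv.trans (le_abs_self v))

lemma norm_le_one (hρ : IsLoss ρ) (u : ℝ) : ‖ρ u‖ ≤ 1 := by
  rw [Real.norm_eq_abs, abs_of_nonneg (hρ.nonneg u)]
  exact hρ.le_one u

lemma measurable (hρ : IsLoss ρ) : Measurable ρ := by
  have h : Monotone fun u : ℝ => ρ (max u 0) := fun u v huv =>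
    hρ.mono (le_max_right u 0) (le_max_right v 0) (max_le_max_right 0 huv)
  have h2 : ρ = (fun u : ℝ => ρ (max u 0)) ∘ fun u => |u| := by
    ext u
    simp [hρ.apply_abs]
  rw [h2]
  exact h.measurable.comp measurable_id.abs

lemma integrable_comp (hρ : IsLoss ρ) {X : Type*} [MeasurableSpace X] (μ : Measure X)
    [IsFiniteMeasure μ] {f : X → ℝ} (hf : Measurable f) : Integrable (fun x => ρ (f x)) μ :=
  Integrable.of_bound (hρ.measurable.comp hf).aestronglyMeasurable 1
    (Eventually.of_forall fun x => hρ.norm_le_one (f x))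

lemma integral_nonneg (hρ : IsLoss ρ) {X : Type*} [MeasurableSpace X] (μ : Measure X)
    (f : X → ℝ) : 0 ≤ ∫ x, ρ (f x) ∂μ :=
  MeasureTheory.integral_nonneg fun x => hρ.nonneg (f x)

lemma integral_le_one (hρ : IsLoss ρ) {X : Type*} [MeasurableSpace X] (μ : Measure X)
    [IsProbabilityMeasure μ] {f : X → ℝ} (hf : Measurable f) : ∫ x, ρ (f x) ∂μ ≤ 1 := by
  simpa using integral_mono (hρ.integrable_comp μ hf) (integrable_const 1)
    fun x => hρ.le_one (f x)

end IsLoss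

/-! ### The function `g` and its inverse -/

lemma g_antitoneOn (hρ : IsLoss ρ) : AntitoneOn (g ρ) (Set.Ioi 0) := by
  intro s hs t ht hst
  refine integral_mono (hρ.integrable_comp _ (by fun_prop)) (hρ.integrable_comp _ (by fun_prop))
    fun z => hρ.le_of_abs_le ?_
  rw [abs_div, abs_div, abs_of_pos (show 0 < s from hs), abs_of_pos (show 0 < t from ht)]
  exact div_le_div_of_nonneg_left (abs_nonneg z) hs hst

lemma g_nonneg (hρ : IsLoss ρ) (s : ℝ) : 0 ≤ g ρ s := hρ.integral_nonneg _ _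

/-- A loss that takes a value below `1` away from the origin makes `g` strictly decreasing. -/
lemma g_strictAntiOn (hρ : IsLoss ρ) {u : ℝ} (hu : 0 < u) (hu1 : ρ u < 1) :
    StrictAntiOn (g ρ) (Set.Ioi 0) := by
  intro s hs t ht hst
  replace hs : 0 < s := hs
  replace ht : 0 < t := ht
  refine lt_of_le_of_ne (g_antitoneOn hρ hs ht hst.le) fun heq => ?_
  have hle : ∀ z : ℝ, ρ (z / t) ≤ ρ (z / s) := fun z => hρ.le_of_abs_le <| by
    rw [abs_div, abs_div, abs_of_pos hs, abs_of_pos ht]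
    exact div_le_div_of_nonneg_left (abs_nonneg z) hs hst.le
  -- Equal integrals of ordered integrands force equality almost everywhere, hence on a dense set;
  -- monotonicity then extends it to all points at the price of a strict gap `w < w'`.
  have hae : ∀ᵐ z ∂(volume : Measure ℝ), ρ (z / t) = ρ (z / s) := by
    refine (gaussianReal_absolutelyContinuous' 0 one_ne_zero).ae_le ?_
    exact (integral_eq_iff_of_ae_le (hρ.integrable_comp _ (by fun_prop))
      (hρ.integrable_comp _ (by fun_prop)) (Eventually.of_forall hle)).1 heq
  have hdense := Measure.dense_of_ae hae
  have step : ∀ w w' : ℝ, 0 < w → w < w' → ρ (w / s) ≤ ρ (w' / t) := by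
    intro w w' hw hww
    obtain ⟨z, hz, hz1, hz2⟩ := hdense.exists_between hww
    have hz0 : 0 < z := hw.trans hz1
    calc ρ (w / s) ≤ ρ (z / s) := hρ.mono (by simp; positivity) (by simp; positivity) (by gcongr)
      _ = ρ (z / t) := hz.symm
      _ ≤ ρ (w' / t) := hρ.mono (by simp; positivity) (Set.mem_Ici.2
          (div_nonneg (hz0.trans hz2).le ht.le)) (by gcongr)
  -- Taking `r` strictly below `t / s` pays for that gap. Iterating `ρ (r x) ≤ ρ x` from `u` carries
  -- the argument to infinity, where the loss tends to `1 > ρ u`.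
  obtain ⟨r, hr1, hr2⟩ := exists_between ((one_lt_div hs).2 hst)
  have hr0 : 0 < r := one_pos.trans hr1
  have scale : ∀ x : ℝ, 0 < x → ρ (r * x) ≤ ρ x := by
    intro x hx
    have h := step (r * x * s) (x * t) (by positivity) (by
      rw [lt_div_iff₀ hs] at hr2
      nlinarith)
    rwa [mul_div_cancel_right₀ _ hs.ne', mul_div_cancel_right₀ _ ht.ne'] at h
  have iter : ∀ n : ℕ, ρ (r ^ n * u) ≤ ρ u := by
    intro n
    induction n with
    | zero => simp
    | succ n ih =>
      rw [pow_succ', mul_assoc]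
      exact (scale _ (by positivity)).trans ih
  have hlim : Tendsto (fun n : ℕ => ρ (r ^ n * u)) atTop (𝓝 1) :=
    hρ.tendsto_one.comp ((tendsto_pow_atTop_atTop_of_one_lt hr1).atTop_mul_const hu)
  exact absurd (le_of_tendsto' hlim iter) (not_le.2 hu1)

/-- Dominated convergence: the finitely many discontinuities of `ρ`, rescaled by `s`, form a
Gaussian null set. -/
lemma g_continuousOn (hρ : IsLoss ρ) : ContinuousOn (g ρ) (Set.Ioi 0) := by
  intro s hs
  replace hs : 0 < s := hs
  refine ContinuousAt.continuousWithinAt ?_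
  refine continuousAt_of_dominated (bound := fun _ => 1)
    (Eventually.of_forall fun t => (hρ.measurable.comp (by fun_prop)).aestronglyMeasurable)
    (Eventually.of_forall fun t => Eventually.of_forall fun z => hρ.norm_le_one _)
    (integrable_const 1) ?_
  have hfin : ((fun u : ℝ => u * s) '' {u | ¬ ContinuousAt ρ u}).Finite :=
    hρ.finite_discontinuities.image _
  have := nullSingletonClass_gaussianReal (μ := 0) (v := 1) one_ne_zero
  have hae := (compl_mem_ae_iff.2 (hfin.measure_zero (gaussianReal 0 1)))
  filter_upwards [hae] with z hz
  have hc : ContinuousAt ρ (z / s) := by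
    by_contra h
    exact hz ⟨z / s, h, div_mul_cancel₀ z hs.ne'⟩
  exact ContinuousAt.comp (f := fun t : ℝ => z / t) hc
    (continuousAt_const.div continuousAt_id hs.ne')

lemma tendsto_g_zero (hρ : IsLoss ρ) : Tendsto (g ρ) (𝓝[>] 0) (𝓝 1) := by
  have h : Tendsto (g ρ) (𝓝[>] 0) (𝓝 (∫ _z, (1 : ℝ) ∂(gaussianReal 0 1))) := by
    refine tendsto_integral_filter_of_dominated_convergence (fun _ => 1)
      (Eventually.of_forall fun t => (hρ.measurable.comp (by fun_prop)).aestronglyMeasurable)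
      (Eventually.of_forall fun t => Eventually.of_forall fun z => hρ.norm_le_one _)
      (integrable_const 1) ?_
    have := nullSingletonClass_gaussianReal (μ := 0) (v := 1) one_ne_zero
    filter_upwards [compl_mem_ae_iff.2 (measure_singleton (μ := gaussianReal 0 1) (0 : ℝ))] with z hz
    have hz0 : 0 < |z| := abs_pos.2 hz
    have h1 : Tendsto (fun s : ℝ => ρ (|z| * s⁻¹)) (𝓝[>] 0) (𝓝 1) :=
      hρ.tendsto_one.comp (tendsto_inv_nhdsGT_zero.const_mul_atTop hz0)
    refine h1.congr' ?_
    filter_upwards [self_mem_nhdsWithin] with s hs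
    rw [← hρ.apply_abs (z / s), abs_div, abs_of_pos (show 0 < s from hs), div_eq_mul_inv]
  simpa using h

lemma exists_g_lt (hρ : IsLoss ρ) {u v : ℝ} (hu : 0 < u) (huv : ρ u < v) :
    ∃ s, 0 < s ∧ g ρ s < v := by
  -- Truncation from below at `ρ u` makes the integrand equal to `ρ u` as soon as `|z| / s ≤ u`, so
  -- continuity of `ρ` at `0` is not needed.
  have h : Tendsto (fun s => ∫ z, max (ρ (z / s)) (ρ u) ∂(gaussianReal 0 1)) atTop
      (𝓝 (∫ _z, ρ u ∂(gaussianReal 0 1))) := by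
    refine tendsto_integral_filter_of_dominated_convergence (fun _ => 1)
      (Eventually.of_forall fun t =>
        ((hρ.measurable.comp (by fun_prop)).max measurable_const).aestronglyMeasurable)
      (Eventually.of_forall fun t => Eventually.of_forall fun z => ?_)
      (integrable_const 1) (Eventually.of_forall fun z => ?_)
    · rw [Real.norm_eq_abs, abs_of_nonneg (le_max_of_le_right (hρ.nonneg u))]
      exact max_le (hρ.le_one _) (hρ.le_one _)
    · refine tendsto_const_nhds.congr' ?_
      filter_upwards [eventually_ge_atTop (|z| / u), eventually_gt_atTop 0] with s hs hs0
      refine (max_eq_right (hρ.le_of_abs_le ?_)).symm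
      rw [abs_div, abs_of_pos hs0, abs_of_pos hu]
      rwa [div_le_iff₀ hs0, mul_comm, ← div_le_iff₀ hu]
  simp only [integral_const, probReal_univ, one_smul] at h
  obtain ⟨s, hs, hs0⟩ := ((h.eventually_lt_const huv).and (eventually_gt_atTop 0)).exists
  refine ⟨s, hs0, lt_of_le_of_lt ?_ hs⟩
  have hi := hρ.integrable_comp (gaussianReal 0 1) (f := fun z => z / s) (by fun_prop)
  exact integral_mono hi (hi.sup (integrable_const _)) fun z => le_max_left _ _

lemma exists_g_eq (hρ : IsLoss ρ) {u v : ℝ} (hu : 0 < u) (huv : ρ u < v) (hv : v < 1) :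
    ∃ s ∈ Set.Ioi (0 : ℝ), g ρ s = v := by
  obtain ⟨s, hs0, hs⟩ := exists_g_lt hρ hu huv
  obtain ⟨t, ht, ht0⟩ :=
    (((tendsto_g_zero hρ).eventually_const_lt hv).and self_mem_nhdsWithin).exists
  exact isPreconnected_Ioi.intermediate_value hs0 ht0 (g_continuousOn hρ) ⟨hs.le, ht.le⟩

lemma gInv_pos (hρ : IsLoss ρ) {u v : ℝ} (hu : 0 < u) (huv : ρ u < v) (hv : v < 1) :
    0 < gInv ρ v :=
  Function.invFunOn_mem (exists_g_eq hρ hu huv hv)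

lemma g_gInv (hρ : IsLoss ρ) {u v : ℝ} (hu : 0 < u) (huv : ρ u < v) (hv : v < 1) :
    g ρ (gInv ρ v) = v :=
  Function.invFunOn_eq (exists_g_eq hρ hu huv hv)

/-! ### Shifted Gaussian residuals -/

/-- Anderson's inequality for a standard normal variable: shifting it increases the mean of an
even function that increases away from the origin. -/
lemma integral_le_integral_shift {k : ℝ → ℝ} (hk : Measurable k)
    (hk1 : ∀ u, ‖k u‖ ≤ 1) (hmono : ∀ u v : ℝ, |u| ≤ |v| → k u ≤ k v) (a : ℝ) :
    ∫ z, k z ∂(gaussianReal 0 1) ≤ ∫ z, k (z - a) ∂(gaussianReal 0 1) := by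
  have hsymm : ∀ u, k (-u) = k u := fun u =>
    le_antisymm (hmono _ _ (by simp)) (hmono _ _ (by simp))
  set φ := gaussianPDFReal 0 1 with hφ
  have hφi : Integrable φ := integrable_gaussianPDFReal 0 1
  have hφmono : ∀ u v : ℝ, |u| ≤ |v| → φ v ≤ φ u := by
    intro u v huv
    have := sq_le_sq.2 huv
    simp only [hφ, gaussianPDFReal, sub_zero, NNReal.coe_one, mul_one]
    gcongr
  have hi1 : Integrable fun z => φ z * k z :=
    hφi.mul_bdd hk.aestronglyMeasurable (Eventually.of_forall hk1)
  have hi2 : Integrable fun z => φ z * k (z - a) :=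
    hφi.mul_bdd (hk.comp (by fun_prop)).aestronglyMeasurable (Eventually.of_forall fun z => hk1 _)
  have hi : Integrable fun z => φ z * (k (z - a) - k z) := by
    simp only [mul_sub]
    exact hi2.sub hi1
  rw [integral_gaussianReal_eq_integral_smul one_ne_zero,
    integral_gaussianReal_eq_integral_smul one_ne_zero]
  simp only [smul_eq_mul, ← hφ]
  rw [← sub_nonneg, ← integral_sub hi2 hi1]
  simp only [← mul_sub]
  -- The reflection `z ↦ a - z` negates `k (z - a) - k z`. Twice the difference of the means is thus
  -- the integral of `(φ z - φ (a - z)) (k (z - a) - k z)`, whose factors never have opposite signs.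
  have hrefl : ∫ z, φ (a - z) * (k (z - a) - k z) = - ∫ z, φ z * (k (z - a) - k z) := by
    rw [← integral_sub_left_eq_self _ volume a, ← integral_neg]
    refine integral_congr_ae (Eventually.of_forall fun z => ?_)
    have h1 : k (a - z) = k (z - a) := by rw [← hsymm, neg_sub]
    have h2 : k (a - z - a) = k z := by rw [← hsymm]; ring_nf
    simp only [sub_sub_cancel, h1, h2]
    ring
  have hi' : Integrable fun z => φ (a - z) * (k (z - a) - k z) := by
    have := (hi.comp_sub_left a).neg
    refine this.congr (Eventually.of_forall fun z => ?_)
    have h1 : k (a - z) = k (z - a) := by rw [← hsymm, neg_sub]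
    have h2 : k (a - z - a) = k z := by rw [← hsymm]; ring_nf
    simp only [Pi.neg_apply, h1, h2]
    ring
  have hpos : 0 ≤ ∫ z, (φ z * (k (z - a) - k z) - φ (a - z) * (k (z - a) - k z)) := by
    refine MeasureTheory.integral_nonneg fun z => ?_
    simp only [Pi.zero_apply]
    rw [← sub_mul]
    rcases le_total |z| |z - a| with h | h
    · exact mul_nonneg (sub_nonneg.2 (hφmono _ _ (by rwa [abs_sub_comm a z])))
        (sub_nonneg.2 (hmono _ _ h))
    · exact mul_nonneg_of_nonpos_of_nonpos
        (sub_nonpos.2 (hφmono _ _ (by rwa [abs_sub_comm a z]))) (sub_nonpos.2 (hmono _ _ h))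
  rw [integral_sub hi hi', hrefl] at hpos
  linarith

lemma g_le_integral_shift (hρ : IsLoss ρ) {τ σ : ℝ} (hτ : 0 < τ) (hσ : 0 < σ) (α : ℝ) :
    g ρ (σ / τ) ≤ ∫ z, ρ ((τ * z - α) / σ) ∂(gaussianReal 0 1) := by
  have h := integral_le_integral_shift (k := fun z => ρ (z / (σ / τ)))
    (hρ.measurable.comp (by fun_prop)) (fun z => hρ.norm_le_one _)
    (fun u v huv => hρ.le_of_abs_le (by
      rw [abs_div u, abs_div v]
      exact div_le_div_of_nonneg_right huv (abs_nonneg _))) (α / τ)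
  refine h.trans_eq (integral_congr_ae (Eventually.of_forall fun z => ?_))
  simp only
  congr 1
  field_simp

/-- With slope scale and residual scale bounded, a large intercept makes the mean loss close
to `1`. -/
lemma exists_bound_shift (hρ : IsLoss ρ) {v R S : ℝ} (hv : v < 1) (hS : 0 < S) :
    ∃ M : ℝ, ∀ τ σ α : ℝ, 0 ≤ τ → τ ≤ R → 0 < σ → σ ≤ S →
      ∫ z, ρ ((τ * z - α) / σ) ∂(gaussianReal 0 1) ≤ v → |α| ≤ M := by
  -- This integrand bounds the loss from below for all admissible `τ`, `σ` and `|α| ≥ m` at once.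
  have h : Tendsto (fun m => ∫ z, ρ (max ((m - R * |z|) / S) 0) ∂(gaussianReal 0 1)) atTop
      (𝓝 (∫ _z, (1 : ℝ) ∂(gaussianReal 0 1))) := by
    refine tendsto_integral_filter_of_dominated_convergence (fun _ => 1)
      (Eventually.of_forall fun t => (hρ.measurable.comp (by fun_prop)).aestronglyMeasurable)
      (Eventually.of_forall fun t => Eventually.of_forall fun z => hρ.norm_le_one _)
      (integrable_const 1) (Eventually.of_forall fun z => ?_)
    refine hρ.tendsto_one.comp (tendsto_atTop_mono (fun m => le_max_left _ _) ?_)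
    exact (tendsto_atTop_add_const_right _ _ tendsto_id).atTop_div_const hS
  simp only [integral_const, probReal_univ, one_smul] at h
  obtain ⟨m, hm⟩ := (h.eventually_const_lt hv).exists
  refine ⟨m, fun τ σ α hτ0 hτ hσ0 hσ hle => ?_⟩
  by_contra! hα
  refine absurd (hm.trans_le ((integral_mono (hρ.integrable_comp _ (by fun_prop))
    (hρ.integrable_comp _ (by fun_prop)) fun z => hρ.le_of_abs_le ?_).trans hle)) (lt_irrefl v)
  rw [abs_of_nonneg (le_max_right _ _)]
  refine max_le ?_ (abs_nonneg _)
  rw [abs_div, abs_of_pos hσ0]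
  have h1 : m - R * |z| ≤ |τ * z - α| := by
    have h2 : |α| ≤ |τ * z - α| + |τ * z| := by
      have := abs_sub_abs_le_abs_sub α (τ * z)
      rw [abs_sub_comm] at this
      linarith
    rw [abs_mul, abs_of_nonneg hτ0] at h2
    have h3 : τ * |z| ≤ R * |z| := by gcongr
    linarith
  exact (div_le_div_of_nonneg_right h1 hS.le).trans
    (div_le_div_of_nonneg_left (abs_nonneg _) hσ0 hσ)

/-! ### Mean loss under the Gaussian model and its contaminations -/

variable {p : ℕ}

/-- The standard deviation `√(1 + ‖θ‖²)` of `y - x'θ` under the Gaussian model. -/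
def slopeScale (θ : EuclideanSpace ℝ (Fin p)) : ℝ := √(1 + ‖θ‖ ^ 2)

lemma one_le_slopeScale (θ : EuclideanSpace ℝ (Fin p)) : 1 ≤ slopeScale θ :=
  Real.one_le_sqrt.2 (by linarith [sq_nonneg ‖θ‖])

lemma slopeScale_pos (θ : EuclideanSpace ℝ (Fin p)) : 0 < slopeScale θ :=
  one_pos.trans_le (one_le_slopeScale θ)

lemma continuous_slopeScale :
    Continuous (slopeScale : EuclideanSpace ℝ (Fin p) → ℝ) := by
  unfold slopeScale
  fun_prop

lemma norm_le_slopeScale (θ : EuclideanSpace ℝ (Fin p)) : ‖θ‖ ≤ slopeScale θ :=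
  Real.le_sqrt_of_sq_le (by linarith)

lemma log_slopeScale (θ : EuclideanSpace ℝ (Fin p)) :
    Real.log (slopeScale θ) = Real.log (1 + ‖θ‖ ^ 2) / 2 :=
  Real.log_sqrt (by positivity)

lemma map_inner_stdGaussian (θ : EuclideanSpace ℝ (Fin p)) :
    (stdGaussian (EuclideanSpace ℝ (Fin p))).map (fun x => -inner ℝ x θ) =
      gaussianReal 0 (‖θ‖ ^ 2).toNNReal := by
  have h := IsGaussian.map_eq_gaussianReal (μ := stdGaussian (EuclideanSpace ℝ (Fin p)))
    (innerSL ℝ (-θ))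
  rw [integral_strongDual_stdGaussian, variance_dual_stdGaussian, innerSL_apply_norm,
    norm_neg] at h
  rw [← h]
  congr 1
  ext x
  simp [real_inner_comm]

/-- A sum of independent centred normals with variances `1` and `‖θ‖²`. -/
lemma map_residual_gaussianModel (θ : EuclideanSpace ℝ (Fin p)) :
    (gaussianModel p).map (fun w => w.1 - inner ℝ w.2 θ) =
      (gaussianReal 0 1).map (fun z => slopeScale θ * z) := by
  have h1 : (fun w : Obs p => w.1 - inner ℝ w.2 θ) =
      (fun z : ℝ × ℝ => z.1 + z.2) ∘ Prod.map id (fun x => -inner ℝ x θ) := by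
    ext w
    simp [sub_eq_add_neg]
  rw [h1, ← Measure.map_map (by fun_prop) (by fun_prop), gaussianModel,
    ← Measure.map_prod_map _ _ measurable_id (by fun_prop), Measure.map_id,
    map_inner_stdGaussian, gaussianReal_map_const_mul]
  refine (gaussianReal_conv_gaussianReal (m₁ := 0) (m₂ := 0) (v₁ := 1)
    (v₂ := (‖θ‖ ^ 2).toNNReal)).trans ?_
  congr 1
  · simp
  · ext
    simp only [NNReal.coe_add, NNReal.coe_one, NNReal.coe_mk, mul_one]
    rw [Real.coe_toNNReal _ (by positivity), slopeScale, Real.sq_sqrt (by positivity)]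

instance : IsProbabilityMeasure (gaussianModel p) := by
  unfold gaussianModel
  infer_instance

lemma meanLoss_gaussianModel (hρ : IsLoss ρ) (q : Param p) :
    meanLoss ρ (gaussianModel p) q =
      ∫ z, ρ ((slopeScale q.2.1 * z - q.1) / q.2.2) ∂(gaussianReal 0 1) := by
  have hm : Measurable fun r : ℝ => ρ ((r - q.1) / q.2.2) := hρ.measurable.comp (by fun_prop)
  have h := integral_map (μ := gaussianModel p) (φ := fun w => w.1 - inner ℝ w.2 q.2.1)
    (by fun_prop) (f := fun r : ℝ => ρ ((r - q.1) / q.2.2)) hm.aestronglyMeasurable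
  rw [map_residual_gaussianModel, integral_map (by fun_prop) hm.aestronglyMeasurable] at h
  rw [h, meanLoss]
  simp only [sub_right_comm]

lemma meanLoss_nonneg (hρ : IsLoss ρ) (H : Measure (Obs p)) (q : Param p) :
    0 ≤ meanLoss ρ H q := hρ.integral_nonneg _ _

lemma meanLoss_le_one (hρ : IsLoss ρ) (H : Measure (Obs p)) [IsProbabilityMeasure H]
    (q : Param p) : meanLoss ρ H q ≤ 1 := hρ.integral_le_one _ (by fun_prop)

lemma g_le_meanLoss_gaussianModel (hρ : IsLoss ρ) {q : Param p} (hq : 0 < q.2.2) :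
    g ρ (q.2.2 / slopeScale q.2.1) ≤ meanLoss ρ (gaussianModel p) q := by
  rw [meanLoss_gaussianModel hρ]
  exact g_le_integral_shift hρ (slopeScale_pos _) hq _

lemma meanLoss_gaussianModel_zero (hρ : IsLoss ρ) (θ : EuclideanSpace ℝ (Fin p)) (s : ℝ) :
    meanLoss ρ (gaussianModel p) (0, θ, s * slopeScale θ) = g ρ s := by
  rw [meanLoss_gaussianModel hρ, g]
  congr with z
  have := (slopeScale_pos θ).ne'
  simp only [sub_zero]
  rw [mul_comm s, mul_div_mul_left _ _ this]

lemma meanLoss_contaminated (hρ : IsLoss ρ) {ε : ℝ} (hε0 : 0 ≤ ε) (hε1 : ε ≤ 1)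
    (Hs : Measure (Obs p)) [IsProbabilityMeasure Hs] (q : Param p) :
    meanLoss ρ (ENNReal.ofReal (1 - ε) • gaussianModel p + ENNReal.ofReal ε • Hs) q =
      (1 - ε) * meanLoss ρ (gaussianModel p) q + ε * meanLoss ρ Hs q := by
  have hi : ∀ H : Measure (Obs p), IsProbabilityMeasure H →
      Integrable (fun w : Obs p => ρ ((w.1 - q.1 - inner ℝ w.2 q.2.1) / q.2.2)) H :=
    fun H _ => hρ.integrable_comp H (by fun_prop)
  unfold meanLoss
  rw [integral_add_measure ((hi _ inferInstance).smul_measure ENNReal.ofReal_ne_top)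
    ((hi _ inferInstance).smul_measure ENNReal.ofReal_ne_top), integral_smul_measure,
    integral_smul_measure, ENNReal.toReal_ofReal (by linarith), ENNReal.toReal_ofReal hε0,
    smul_eq_mul, smul_eq_mul]

lemma isProbabilityMeasure_contaminated {ε : ℝ} (hε0 : 0 ≤ ε) (hε1 : ε ≤ 1)
    (Hs : Measure (Obs p)) [IsProbabilityMeasure Hs] :
    IsProbabilityMeasure
      (ENNReal.ofReal (1 - ε) • gaussianModel p + ENNReal.ofReal ε • Hs) := by
  refine ⟨?_⟩
  simp only [Measure.coe_add, Measure.coe_smul, Pi.add_apply, Pi.smul_apply, measure_univ,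
    smul_eq_mul, mul_one]
  rw [← ENNReal.ofReal_add (by linarith) hε0]
  simp

/-! ### Bounds for the objective in terms of the relative scale -/

variable {b c ε : ℝ}

/-- The contaminated distribution `(1 - ε) H₀ + ε H*` at the Gaussian model `H₀`. -/
def mixture (ε : ℝ) (Hs : Measure (Obs p)) : Measure (Obs p) :=
  ENNReal.ofReal (1 - ε) • gaussianModel p + ENNReal.ofReal ε • Hs

lemma log_le_A (hρ : IsLoss ρ) (hc : 0 ≤ c) (hε1 : ε ≤ 1) (s : ℝ) :
    Real.log s ≤ A ρ c ε s :=
  le_add_of_nonneg_left (mul_nonneg (mul_nonneg hc (by linarith)) (g_nonneg hρ s))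

lemma bddBelow_A (hρ : IsLoss ρ) (hc : 0 ≤ c) (hε1 : ε ≤ 1) {t : ℝ} (ht : 0 < t) :
    BddBelow (A ρ c ε '' Set.Ici t) := by
  refine ⟨Real.log t, ?_⟩
  rintro _ ⟨s, hs, rfl⟩
  exact (Real.log_le_log ht hs).trans (log_le_A hρ hc hε1 s)

/-- The values at which the loss and the contamination level place the scales `σ_{b,ε}` and
`γ_{b,ε}`. -/
structure Setting (ρ : ℝ → ℝ) (b c ε σ₀ γ₀ : ℝ) : Prop where
  loss : IsLoss ρ
  strictAnti : StrictAntiOn (g ρ) (Set.Ioi 0)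
  c_pos : 0 < c
  eps_nonneg : 0 ≤ ε
  eps_lt : ε < 1 - b
  b_pos : 0 < b
  sigma_pos : 0 < σ₀
  g_sigma : g ρ σ₀ = (b - ε) / (1 - ε)
  gamma_pos : 0 < γ₀
  g_gamma : g ρ γ₀ = b / (1 - ε)

namespace Setting

variable {σ₀ γ₀ : ℝ}

lemma eps_lt_one (h : Setting ρ b c ε σ₀ γ₀) : ε < 1 := by linarith [h.eps_lt, h.b_pos]

lemma gamma_le_sigma (h : Setting ρ b c ε σ₀ γ₀) : γ₀ ≤ σ₀ := by
  refine (h.strictAnti.le_iff_ge h.sigma_pos h.gamma_pos).1 ?_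
  rw [h.g_sigma, h.g_gamma]
  exact div_le_div_of_nonneg_right (by linarith [h.eps_nonneg]) (by linarith [h.eps_lt_one])

lemma bddBelow_A (h : Setting ρ b c ε σ₀ γ₀) {t : ℝ} (ht : 0 < t) :
    BddBelow (A ρ c ε '' Set.Ici t) :=
  CMRegression.bddBelow_A h.loss h.c_pos.le h.eps_lt_one.le ht

lemma sInf_gamma_le_sInf_sigma (h : Setting ρ b c ε σ₀ γ₀) :
    sInf (A ρ c ε '' Set.Ici γ₀) ≤ sInf (A ρ c ε '' Set.Ici σ₀) :=
  csInf_le_csInf (h.bddBelow_A h.gamma_pos) (Set.nonempty_Ici.image _)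
    (Set.image_mono (Set.Ici_subset_Ici.2 h.gamma_le_sigma))

lemma meanLoss_mixture (h : Setting ρ b c ε σ₀ γ₀) (Hs : Measure (Obs p))
    [IsProbabilityMeasure Hs] (q : Param p) :
    meanLoss ρ (mixture ε Hs) q =
      (1 - ε) * meanLoss ρ (gaussianModel p) q + ε * meanLoss ρ Hs q :=
  meanLoss_contaminated h.loss h.eps_nonneg h.eps_lt_one.le Hs q

lemma meanLoss_gaussianModel_le (h : Setting ρ b c ε σ₀ γ₀) {Hs : Measure (Obs p)}
    [IsProbabilityMeasure Hs] {q : Param p} (hq : q ∈ feasible ρ b (mixture ε Hs)) :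
    meanLoss ρ (gaussianModel p) q ≤ b / (1 - ε) := by
  have h1 := hq.2
  rw [h.meanLoss_mixture] at h1
  rw [le_div_iff₀ (by linarith [h.eps_lt_one])]
  have := mul_nonneg h.eps_nonneg (meanLoss_nonneg h.loss Hs q)
  linarith

/-- Even contamination with zero loss leaves the Gaussian part a budget of only `b / (1 - ε)`;
Anderson's bound and strict monotonicity of `g` turn this into a bound on the scale. -/
lemma gamma_le_ratio (h : Setting ρ b c ε σ₀ γ₀) {Hs : Measure (Obs p)}
    [IsProbabilityMeasure Hs] {q : Param p} (hq : q ∈ feasible ρ b (mixture ε Hs)) :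
    γ₀ ≤ q.2.2 / slopeScale q.2.1 := by
  refine (h.strictAnti.le_iff_ge (div_pos hq.1 (slopeScale_pos _)) h.gamma_pos).1 ?_
  rw [h.g_gamma]
  exact (g_le_meanLoss_gaussianModel h.loss hq.1).trans (h.meanLoss_gaussianModel_le hq)

lemma le_objective (h : Setting ρ b c ε σ₀ γ₀) (Hs : Measure (Obs p))
    [IsProbabilityMeasure Hs] {q : Param p} (hq : 0 < q.2.2) :
    A ρ c ε (q.2.2 / slopeScale q.2.1) + Real.log (slopeScale q.2.1) + c * ε * meanLoss ρ Hs q ≤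
      objective ρ c (mixture ε Hs) q := by
  have h1 := g_le_meanLoss_gaussianModel h.loss hq
  have h2 : c * (1 - ε) * g ρ (q.2.2 / slopeScale q.2.1) ≤
      c * (1 - ε) * meanLoss ρ (gaussianModel p) q :=
    mul_le_mul_of_nonneg_left h1 (mul_nonneg h.c_pos.le (by linarith [h.eps_lt_one]))
  rw [objective, h.meanLoss_mixture, A, Real.log_div hq.ne' (slopeScale_pos _).ne']
  linarith

lemma sInf_gamma_add_le_objective (h : Setting ρ b c ε σ₀ γ₀) {Hs : Measure (Obs p)}
    [IsProbabilityMeasure Hs] {q : Param p} (hq : q ∈ feasible ρ b (mixture ε Hs)) :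
    sInf (A ρ c ε '' Set.Ici γ₀) + Real.log (slopeScale q.2.1) ≤
      objective ρ c (mixture ε Hs) q := by
  have h1 := csInf_le (h.bddBelow_A h.gamma_pos) (Set.mem_image_of_mem (A ρ c ε)
    (Set.mem_Ici.2 (h.gamma_le_ratio hq)))
  have h2 := mul_nonneg (mul_nonneg h.c_pos.le h.eps_nonneg) (meanLoss_nonneg h.loss Hs q)
  linarith [h.le_objective Hs hq.1]

/-- Points with vanishing intercept and slopes stay feasible when the scale is at least
`σ_{b,ε}`. -/
lemma zero_mem_feasible (h : Setting ρ b c ε σ₀ γ₀) (Hs : Measure (Obs p))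
    [IsProbabilityMeasure Hs] {s : ℝ} (hs : σ₀ ≤ s) :
    ((0, 0, s) : Param p) ∈ feasible ρ b (mixture ε Hs) ∧
      objective ρ c (mixture ε Hs) (0, 0, s) ≤ A ρ c ε s + c * ε := by
  have hs0 : 0 < s := h.sigma_pos.trans_le hs
  have h1 : meanLoss ρ (gaussianModel p) (0, 0, s) = g ρ s := by
    have := meanLoss_gaussianModel_zero (p := p) h.loss 0 s
    simpa [slopeScale] using this
  have h2 := mul_le_mul_of_nonneg_left (meanLoss_le_one h.loss Hs (0, 0, s)) h.eps_nonneg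
  have h3 : g ρ s ≤ (b - ε) / (1 - ε) := by
    rw [← h.g_sigma]
    exact h.strictAnti.antitoneOn h.sigma_pos hs0 hs
  rw [le_div_iff₀ (by linarith [h.eps_lt_one])] at h3
  refine ⟨⟨hs0, ?_⟩, ?_⟩
  · rw [h.meanLoss_mixture, h1]
    linarith
  · rw [objective, h.meanLoss_mixture, h1, A]
    have := mul_le_mul_of_nonneg_left h2 h.c_pos.le
    linarith

/-- Worst case for zero slopes: the contamination incurs loss at most `1`, whatever it is. -/
lemma isGLB_le_sigma (h : Setting ρ b c ε σ₀ γ₀) {Hs : Measure (Obs p)}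
    [IsProbabilityMeasure Hs] {l : ℝ}
    (hl : IsGLB (objective ρ c (mixture ε Hs) '' feasible ρ b (mixture ε Hs)) l) :
    l ≤ sInf (A ρ c ε '' Set.Ici σ₀) + c * ε := by
  rw [← sub_le_iff_le_add]
  refine le_csInf (Set.nonempty_Ici.image _) ?_
  rintro _ ⟨s, hs, rfl⟩
  obtain ⟨h1, h2⟩ := h.zero_mem_feasible Hs hs
  rw [sub_le_iff_le_add]
  exact (hl.1 ⟨_, h1, rfl⟩).trans h2

/-- When the contamination lies on the hyperplane `y = x'θ`, the points with these slopes stay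
feasible when the relative scale is at least `γ_{b,ε}`. -/
lemma isGLB_le_gamma (h : Setting ρ b c ε σ₀ γ₀) {Hs : Measure (Obs p)}
    [IsProbabilityMeasure Hs] (θ : EuclideanSpace ℝ (Fin p))
    (hθ : ∀ σ : ℝ, meanLoss ρ Hs (0, θ, σ) = 0) {l : ℝ}
    (hl : IsGLB (objective ρ c (mixture ε Hs) '' feasible ρ b (mixture ε Hs)) l) :
    l ≤ sInf (A ρ c ε '' Set.Ici γ₀) + Real.log (slopeScale θ) := by
  rw [← sub_le_iff_le_add]
  refine le_csInf (Set.nonempty_Ici.image _) ?_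
  rintro _ ⟨s, hs, rfl⟩
  have hs0 : 0 < s := h.gamma_pos.trans_le hs
  have hm : meanLoss ρ (mixture ε Hs) (0, θ, s * slopeScale θ) = (1 - ε) * g ρ s := by
    rw [h.meanLoss_mixture, meanLoss_gaussianModel_zero h.loss, hθ]
    ring
  have h3 : g ρ s ≤ b / (1 - ε) := by
    rw [← h.g_gamma]
    exact h.strictAnti.antitoneOn h.gamma_pos hs0 hs
  rw [le_div_iff₀ (by linarith [h.eps_lt_one])] at h3
  have hq : (0, θ, s * slopeScale θ) ∈ feasible ρ b (mixture ε Hs) :=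
    ⟨mul_pos hs0 (slopeScale_pos θ), by rw [hm]; linarith⟩
  rw [sub_le_iff_le_add]
  refine (hl.1 ⟨_, hq, rfl⟩).trans_eq ?_
  rw [objective, hm, A, Real.log_mul hs0.ne' (slopeScale_pos θ).ne']
  ring

/-! ### Compactness, existence of solutions and the upper bound -/

/-- Feasible points with bounded objective lie in a compact set that does not depend on the
contamination. -/
lemma exists_bounds (h : Setting ρ b c ε σ₀ γ₀) (p : ℕ) (K : ℝ) :
    ∃ M R S : ℝ, ∀ Hs : Measure (Obs p), IsProbabilityMeasure Hs →
      ∀ q ∈ feasible ρ b (mixture ε Hs), objective ρ c (mixture ε Hs) q ≤ K →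
        |q.1| ≤ M ∧ ‖q.2.1‖ ≤ R ∧ γ₀ ≤ q.2.2 ∧ q.2.2 ≤ S := by
  -- Here `ε < 1 - b` matters: the Gaussian mean loss stays away from `1`, so the intercept cannot
  -- escape to infinity.
  have hv : b / (1 - ε) < 1 := by
    rw [div_lt_one (by linarith [h.eps_lt_one])]
    linarith [h.eps_lt]
  obtain ⟨M, hM⟩ := exists_bound_shift h.loss (v := b / (1 - ε))
    (R := Real.exp (K - sInf (A ρ c ε '' Set.Ici γ₀))) hv (Real.exp_pos K)
  refine ⟨M, Real.exp (K - sInf (A ρ c ε '' Set.Ici γ₀)), Real.exp K,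
    fun Hs _ q hq hK => ?_⟩
  have hτ : slopeScale q.2.1 ≤ Real.exp (K - sInf (A ρ c ε '' Set.Ici γ₀)) := by
    rw [← Real.log_le_iff_le_exp (slopeScale_pos _)]
    linarith [h.sInf_gamma_add_le_objective hq]
  have hσ : q.2.2 ≤ Real.exp K := by
    rw [← Real.log_le_iff_le_exp hq.1]
    have := mul_nonneg h.c_pos.le (meanLoss_nonneg h.loss (mixture ε Hs) q)
    rw [objective] at hK
    linarith
  refine ⟨hM _ _ _ (slopeScale_pos _).le hτ hq.1 hσ ?_, (norm_le_slopeScale _).trans hτ, ?_, hσ⟩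
  · rw [← meanLoss_gaussianModel h.loss]
    exact h.meanLoss_gaussianModel_le hq
  · have h1 := h.gamma_le_ratio hq
    rw [le_div_iff₀ (slopeScale_pos _)] at h1
    exact (le_mul_of_one_le_right h.gamma_pos.le (one_le_slopeScale _)).trans h1

/-- A minimizing sequence stays in a compact set where the scale is at least `γ₀ > 0`. Its cluster
point is a solution without any semicontinuity, since solutions are defined as limits. -/
lemma exists_isCMSolution (h : Setting ρ b c ε σ₀ γ₀) (Hs : Measure (Obs p))
    [IsProbabilityMeasure Hs] : ∃ q, IsCMSolution ρ b c (mixture ε Hs) q := by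
  have hne : (objective ρ c (mixture ε Hs) '' feasible ρ b (mixture ε Hs)).Nonempty :=
    ⟨_, _, (h.zero_mem_feasible Hs le_rfl).1, rfl⟩
  have hbdd : BddBelow (objective ρ c (mixture ε Hs) '' feasible ρ b (mixture ε Hs)) := by
    refine ⟨sInf (A ρ c ε '' Set.Ici γ₀), ?_⟩
    rintro _ ⟨q, hq, rfl⟩
    linarith [h.sInf_gamma_add_le_objective hq, Real.log_nonneg (one_le_slopeScale q.2.1)]
  obtain ⟨v, hanti, hlim, hv⟩ := exists_seq_tendsto_sInf hne hbdd
  choose u hu huv using hv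
  obtain ⟨M, R, S, hb⟩ := h.exists_bounds p (v 0)
  have hK : IsCompact (Metric.closedBall (0 : ℝ) M ×ˢ
      (Metric.closedBall (0 : EuclideanSpace ℝ (Fin p)) R ×ˢ Set.Icc γ₀ S)) :=
    (isCompact_closedBall _ _).prod ((isCompact_closedBall _ _).prod isCompact_Icc)
  have hmem : ∀ n, u n ∈ Metric.closedBall (0 : ℝ) M ×ˢ
      (Metric.closedBall (0 : EuclideanSpace ℝ (Fin p)) R ×ˢ Set.Icc γ₀ S) := by
    intro n
    obtain ⟨h1, h2, h3, h4⟩ := hb Hs inferInstance (u n) (hu n)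
      ((huv n).trans_le (hanti (Nat.zero_le n)))
    exact ⟨by simpa using h1, by simpa using h2, h3, h4⟩
  obtain ⟨q, hq, φ, hφ, hφq⟩ := hK.tendsto_subseq hmem
  refine ⟨q, h.gamma_pos.trans_le hq.2.2.1, _, isGLB_csInf hne hbdd, u ∘ φ, fun n => hu _, hφq, ?_⟩
  refine (hlim.comp hφ.tendsto_atTop).congr fun n => ?_
  exact (huv (φ n)).symm

/-- The solution itself need not be feasible, so the bound is taken along the minimizing sequence
and passed to the limit. -/
lemma log_slopeScale_le (h : Setting ρ b c ε σ₀ γ₀) {Hs : Measure (Obs p)}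
    [IsProbabilityMeasure Hs] {q : Param p} (hq : IsCMSolution ρ b c (mixture ε Hs) q) :
    Real.log (slopeScale q.2.1) ≤
      c * ε + (sInf (A ρ c ε '' Set.Ici σ₀) - sInf (A ρ c ε '' Set.Ici γ₀)) := by
  obtain ⟨-, l, hl, u, hu, huq, hul⟩ := hq
  have h1 : Tendsto (fun n => Real.log (slopeScale (u n).2.1)) atTop
      (𝓝 (Real.log (slopeScale q.2.1))) := by
    have hc : Continuous fun q : Param p => Real.log (slopeScale q.2.1) :=
      (continuous_slopeScale.comp (by fun_prop)).log fun q => (slopeScale_pos _).ne'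
    exact (hc.tendsto q).comp huq
  have h2 := le_of_tendsto_of_tendsto' h1 (hul.sub_const (sInf (A ρ c ε '' Set.Ici γ₀)))
    fun n => by linarith [h.sInf_gamma_add_le_objective (hu n)]
  linarith [h.isGLB_le_sigma hl]

/-! ### The lower bound: remote point contamination -/

/-- If the contamination fits a feasible point badly, the objective there is almost as large as
the values reached with vanishing slopes. -/
lemma le_A_of_meanLoss (h : Setting ρ b c ε σ₀ γ₀) {η : ℝ} (hη : 0 < η) :
    ∃ κ, 0 < κ ∧ κ ≤ η ∧ ∀ Hs : Measure (Obs p), IsProbabilityMeasure Hs →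
      ∀ q ∈ feasible ρ b (mixture ε Hs), 1 - κ ≤ meanLoss ρ Hs q →
        sInf (A ρ c ε '' Set.Ici σ₀) - η ≤ A ρ c ε (q.2.2 / slopeScale q.2.1) := by
  have he : 0 < 1 - ε := by linarith [h.eps_lt_one]
  have hσ' : 0 < σ₀ * Real.exp (-η) := mul_pos h.sigma_pos (Real.exp_pos _)
  have hlt : (b - ε) / (1 - ε) < g ρ (σ₀ * Real.exp (-η)) := by
    rw [← h.g_sigma]
    exact h.strictAnti hσ' h.sigma_pos
      (mul_lt_of_lt_one_right h.sigma_pos (by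
        rw [← Real.exp_zero, Real.exp_lt_exp]
        linarith))
  rw [div_lt_iff₀ he] at hlt
  -- Half the slack in `hlt`: contamination loss at least `1 - κ` leaves the Gaussian part less than
  -- `(1 - ε) g(σ₀ e^{-η})`, so the relative scale exceeds `σ₀ e^{-η}`. Below `σ₀` the term in `g`
  -- only grows, and the logarithm loses at most `η`.
  refine ⟨min η ((g ρ (σ₀ * Real.exp (-η)) * (1 - ε) - (b - ε)) / 2),
    lt_min hη (by linarith), min_le_left _ _, fun Hs _ q hq hκ => ?_⟩
  have hτ := slopeScale_pos q.2.1
  have hs0 : 0 < q.2.2 / slopeScale q.2.1 := div_pos hq.1 hτ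
  rcases le_or_gt σ₀ (q.2.2 / slopeScale q.2.1) with hs | hs
  · linarith [csInf_le (h.bddBelow_A h.sigma_pos) (Set.mem_image_of_mem (A ρ c ε)
      (Set.mem_Ici.2 hs))]
  have hfeas := hq.2
  rw [h.meanLoss_mixture] at hfeas
  have hg := mul_le_mul_of_nonneg_left (g_le_meanLoss_gaussianModel h.loss hq.1) he.le
  have hκ' : 1 - meanLoss ρ Hs q ≤ (g ρ (σ₀ * Real.exp (-η)) * (1 - ε) - (b - ε)) / 2 := by
    linarith [min_le_right η ((g ρ (σ₀ * Real.exp (-η)) * (1 - ε) - (b - ε)) / 2)]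
  have hε := mul_le_mul_of_nonneg_left hκ' h.eps_nonneg
  have hε' : ε * ((g ρ (σ₀ * Real.exp (-η)) * (1 - ε) - (b - ε)) / 2) ≤
      (g ρ (σ₀ * Real.exp (-η)) * (1 - ε) - (b - ε)) / 2 :=
    mul_le_of_le_one_left (by linarith) h.eps_lt_one.le
  have hgs : g ρ (q.2.2 / slopeScale q.2.1) < g ρ (σ₀ * Real.exp (-η)) := by
    refine lt_of_mul_lt_mul_left ?_ he.le
    linarith
  have hs' := (h.strictAnti.lt_iff_gt hs0 hσ').1 hgs
  have hlog := Real.log_le_log hσ' hs'.le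
  rw [Real.log_mul h.sigma_pos.ne' (Real.exp_pos _).ne', Real.log_exp] at hlog
  have hmono := h.strictAnti.antitoneOn hs0 h.sigma_pos hs.le
  have hmul := mul_le_mul_of_nonneg_left hmono (mul_nonneg h.c_pos.le he.le)
  have hA := csInf_le (h.bddBelow_A h.sigma_pos) (Set.mem_image_of_mem (A ρ c ε)
    (Set.self_mem_Ici (a := σ₀)))
  rw [A] at hA ⊢
  linarith

lemma meanLoss_dirac (hρ : IsLoss ρ) (w : Obs p) (q : Param p) :
    meanLoss ρ (Measure.dirac w) q = ρ ((w.1 - q.1 - inner ℝ w.2 q.2.1) / q.2.2) :=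
  integral_dirac' _ _ (hρ.measurable.comp (by fun_prop)).stronglyMeasurable

/-- Remote point contamination near the hyperplane `y = β e'x` pulls every solution at least as
far as `β`, up to an arbitrarily small amount. -/
lemma exists_contamination (h : Setting ρ b c ε σ₀ γ₀) {β δ : ℝ} (hδ : 0 < δ)
    (hβ : Real.log (1 + β ^ 2) / 2 <
      c * ε + (sInf (A ρ c ε '' Set.Ici σ₀) - sInf (A ρ c ε '' Set.Ici γ₀)))
    {e : EuclideanSpace ℝ (Fin p)} (he : ‖e‖ = 1) :
    ∃ Hs : Measure (Obs p), IsProbabilityMeasure Hs ∧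
      ∀ q, IsCMSolution ρ b c (mixture ε Hs) q → β - δ ≤ ‖q.2.1‖ := by
  set mσ := sInf (A ρ c ε '' Set.Ici σ₀)
  set mγ := sInf (A ρ c ε '' Set.Ici γ₀)
  have hlogβ : Real.log (slopeScale (β • e)) = Real.log (1 + β ^ 2) / 2 := by
    rw [log_slopeScale, norm_smul, he, mul_one, Real.norm_eq_abs, sq_abs]
  -- The loss `η` comes from `le_A_of_meanLoss`, and `c ε η` from contamination loss `1 - η` instead
  -- of `1`; together they use half the gap in `hβ`.
  obtain ⟨η, hη0, hη⟩ : ∃ η, 0 < η ∧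
      η + c * ε * η < c * ε + (mσ - mγ) - Real.log (1 + β ^ 2) / 2 := by
    have hpos : 0 < 1 + c * ε := by linarith [mul_nonneg h.c_pos.le h.eps_nonneg]
    refine ⟨(c * ε + (mσ - mγ) - Real.log (1 + β ^ 2) / 2) / (2 * (1 + c * ε)),
      div_pos (by linarith) (by linarith), ?_⟩
    rw [← one_add_mul, mul_div_assoc', div_lt_iff₀ (by linarith)]
    nlinarith
  obtain ⟨κ, hκ0, hκη, hκ⟩ := h.le_A_of_meanLoss (p := p) hη0
  obtain ⟨M, R, S, hb⟩ := h.exists_bounds p (mσ + c * ε + 1)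
  obtain ⟨t, ht, ht0⟩ := ((h.loss.tendsto_one.eventually_const_lt
    (show 1 - κ < 1 by linarith)).and (eventually_ge_atTop 0)).exists
  -- Slopes shorter than `β - δ` leave a residual of at least `r δ - M ≥ t S` at the contaminating
  -- point, and `ρ t > 1 - κ`.
  obtain ⟨r, hr0, hr⟩ : ∃ r : ℝ, 0 ≤ r ∧ t * S + M ≤ r * δ :=
    ⟨max 0 ((t * S + M) / δ), le_max_left _ _, by
      rw [← div_le_iff₀ hδ]
      exact le_max_right _ _⟩
  have hfit : ∀ σ : ℝ, meanLoss ρ (Measure.dirac ((r * β, r • e) : Obs p)) (0, β • e, σ) = 0 := by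
    intro σ
    rw [meanLoss_dirac h.loss]
    simp [inner_smul_left, inner_smul_right, he, mul_comm β r, h.loss.zero]
  refine ⟨Measure.dirac (r * β, r • e), inferInstance, fun q hq => ?_⟩
  by_contra! hqβ
  obtain ⟨-, l, hl, u, hu, huq, hul⟩ := hq
  have hl1 := h.isGLB_le_sigma hl
  have hl2 := h.isGLB_le_gamma _ hfit hl
  rw [hlogβ] at hl2
  have hnorm : Tendsto (fun n => ‖(u n).2.1‖) atTop (𝓝 ‖q.2.1‖) := by
    have hc : Continuous fun q : Param p => ‖q.2.1‖ := by fun_prop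
    exact (hc.tendsto q).comp huq
  -- A late term of the minimizing sequence has short slopes, lies in the compact set, and by the
  -- exact fit `hl2` has an objective too small for a badly fitted contamination.
  obtain ⟨n, ⟨hn1, hn2⟩, hn3⟩ :=
    (((hnorm.eventually_lt_const hqβ).and
      (hul.eventually_lt_const (show l < mσ + c * ε + 1 by linarith))).and
      (hul.eventually_lt_const
        (show l < mσ + c * ε - (η + c * ε * η) by linarith))).exists
  obtain ⟨hα, -, -, hσ⟩ := hb _ inferInstance (u n) (hu n) hn2.le
  have hσ0 : 0 < (u n).2.2 := (hu n).1
  have hres : t ≤ (r * β - (u n).1 - inner ℝ (r • e) (u n).2.1) / (u n).2.2 := by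
    rw [le_div_iff₀ hσ0]
    have h1 : inner ℝ (r • e) (u n).2.1 ≤ r * (β - δ) := by
      rw [real_inner_smul_left]
      refine mul_le_mul_of_nonneg_left ?_ hr0
      have := real_inner_le_norm e (u n).2.1
      rw [he, one_mul] at this
      linarith
    have h2 := mul_le_mul_of_nonneg_left hσ ht0
    have h3 := (abs_le.1 hα).2
    linarith
  have hmean : 1 - κ ≤ meanLoss ρ (Measure.dirac ((r * β, r • e) : Obs p)) (u n) := by
    rw [meanLoss_dirac h.loss]
    exact ht.le.trans (h.loss.mono ht0 (ht0.trans hres) hres)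
  have hA := hκ _ inferInstance (u n) (hu n) hmean
  have hobj := h.le_objective (Measure.dirac ((r * β, r • e) : Obs p)) hσ0
  have hmul := mul_le_mul_of_nonneg_left ((sub_le_sub_left hκη 1).trans hmean)
    (mul_nonneg h.c_pos.le h.eps_nonneg)
  have hlog := Real.log_nonneg (one_le_slopeScale (u n).2.1)
  linarith

end Setting

/-! ### The maximum bias -/

lemma Setting.maxBias_eq (hp : 1 ≤ p)
    (h : Setting ρ b c ε (sigma ρ b ε) (gamma ρ b ε))
    {T : Measure (Obs p) → EuclideanSpace ℝ (Fin p)} (hT : IsCMEstimate ρ b c T) :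
    maxBias (cmDomain p ρ b c) T (gaussianModel p) ε =
      ENNReal.ofReal √(Real.exp (2 * c * ε + 2 * D ρ b c ε) - 1) := by
  have hdom : ∀ Hs : Measure (Obs p), IsProbabilityMeasure Hs →
      mixture ε Hs ∈ cmDomain p ρ b c := fun Hs _ =>
    ⟨isProbabilityMeasure_contaminated h.eps_nonneg h.eps_lt_one.le Hs, h.exists_isCMSolution Hs⟩
  apply le_antisymm
  · refine iSup₂_le ?_
    rintro H ⟨Hs, hHs, rfl⟩
    change bias _ T (mixture ε Hs) ≤ _
    rw [bias, if_pos (hdom Hs hHs)]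
    refine ENNReal.ofReal_le_ofReal (Real.le_sqrt_of_sq_le ?_)
    obtain ⟨α, σ, hsol⟩ := hT _ (hdom Hs hHs)
    have h1 := h.log_slopeScale_le hsol
    rw [log_slopeScale] at h1
    rw [le_sub_iff_add_le', ← Real.log_le_iff_le_exp (by positivity), D]
    simp only at h1
    linarith
  · by_contra! hlt
    lift maxBias (cmDomain p ρ b c) T (gaussianModel p) ε to NNReal using hlt.ne_top
      with y hy
    rw [← ENNReal.ofReal_coe_nnreal] at hlt
    replace hlt := (ENNReal.ofReal_lt_ofReal_iff_of_nonneg y.2).1 hlt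
    -- Two intermediate values: contamination aimed at `β` with tolerance `δ = β - m` still forces a
    -- bias of at least `m > y`.
    obtain ⟨m, hm1, hm2⟩ := exists_between hlt
    obtain ⟨β, hβ1, hβ2⟩ := exists_between hm2
    have hβ0 : 0 ≤ β := (y.2.trans hm1.le).trans hβ1.le
    rw [Real.lt_sqrt hβ0, lt_sub_iff_add_lt', ← Real.log_lt_iff_lt_exp (by positivity), D] at hβ2
    obtain ⟨Hs, hHs, hsol⟩ := h.exists_contamination (β := β) (sub_pos.2 hβ1) (by linarith)
      (e := EuclideanSpace.single (⟨0, hp⟩ : Fin p) (1 : ℝ)) (by simp)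
    obtain ⟨α, σ, hTH⟩ := hT _ (hdom Hs hHs)
    have h1 := hsol _ hTH
    simp only [sub_sub_cancel] at h1
    have h2 : bias (cmDomain p ρ b c) T (mixture ε Hs) ≤ y := by
      rw [hy]
      exact le_iSup₂ (f := fun H _ => bias (cmDomain p ρ b c) T H) (mixture ε Hs) ⟨Hs, hHs, rfl⟩
    rw [bias, if_pos (hdom Hs hHs), ENNReal.ofReal_le_coe] at h2
    exact absurd (h1.trans h2) (not_le.2 hm1)

end CMRegression
end

/-- Maximum bias of a CM-estimate of the regression slopes under the Gaussian model. The first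
conjuncts say that the quantities in the formula are well defined: `g` is injective on `(0, ∞)`,
`σ_{b,ε}` and `γ_{b,ε}` are positive preimages under `g`, the infima are finite, and the radicand
is nonnegative. -/
theorem theorem4p1 (p : ℕ) (hp : 1 ≤ p) (ρ : ℝ → ℝ) (hρ : CMRegression.IsLoss ρ)
    (b c ε : ℝ) (hb0 : 0 < b) (hb1 : b < 1) (hc : 0 < c)
    (hε0 : 0 ≤ ε) (hεb : ε < min b (1 - b))
    (hρ0 : ∃ u : ℝ, 0 < u ∧ ρ u < (b - ε) / (1 - ε))
    (T : Measure (CMRegression.Obs p) → EuclideanSpace ℝ (Fin p))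
    (hT : CMRegression.IsCMEstimate ρ b c T) :
    (Set.InjOn (CMRegression.g ρ) (Set.Ioi 0) ∧
      0 < CMRegression.sigma ρ b ε ∧
      CMRegression.g ρ (CMRegression.sigma ρ b ε) = (b - ε) / (1 - ε) ∧
      0 < CMRegression.gamma ρ b ε ∧
      CMRegression.g ρ (CMRegression.gamma ρ b ε) = b / (1 - ε) ∧
      BddBelow (CMRegression.A ρ c ε '' Set.Ici (CMRegression.sigma ρ b ε)) ∧
      BddBelow (CMRegression.A ρ c ε '' Set.Ici (CMRegression.gamma ρ b ε)) ∧
      0 ≤ Real.exp (2 * c * ε + 2 * CMRegression.D ρ b c ε) - 1) ∧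
    CMRegression.maxBias (CMRegression.cmDomain p ρ b c) T (CMRegression.gaussianModel p) ε =
      ENNReal.ofReal
        (Real.sqrt (Real.exp (2 * c * ε + 2 * CMRegression.D ρ b c ε) - 1)) := by
  obtain ⟨u, hu, hu0⟩ := hρ0
  have hεb' := lt_min_iff.1 hεb
  have hε1 : 0 < 1 - ε := by linarith
  have hle : (b - ε) / (1 - ε) ≤ b / (1 - ε) :=
    div_le_div_of_nonneg_right (by linarith) hε1.le
  have hlt : b / (1 - ε) < 1 := (div_lt_one hε1).2 (by linarith)
  have h : CMRegression.Setting ρ b c ε (CMRegression.sigma ρ b ε) (CMRegression.gamma ρ b ε) :=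
    { loss := hρ
      strictAnti := CMRegression.g_strictAntiOn hρ hu (hu0.trans (hle.trans_lt hlt))
      c_pos := hc
      eps_nonneg := hε0
      eps_lt := hεb'.2
      b_pos := hb0
      sigma_pos := CMRegression.gInv_pos hρ hu hu0 (hle.trans_lt hlt)
      g_sigma := CMRegression.g_gInv hρ hu hu0 (hle.trans_lt hlt)
      gamma_pos := CMRegression.gInv_pos hρ hu (hu0.trans_le hle) hlt
      g_gamma := CMRegression.g_gInv hρ hu (hu0.trans_le hle) hlt }
  refine ⟨⟨h.strictAnti.injOn, h.sigma_pos, h.g_sigma, h.gamma_pos, h.g_gamma,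
    h.bddBelow_A h.sigma_pos, h.bddBelow_A h.gamma_pos, ?_⟩, h.maxBias_eq hp hT⟩
  rw [sub_nonneg, Real.one_le_exp_iff, CMRegression.D]
  have := mul_nonneg hc.le hε0
  linarith [h.sInf_gamma_le_sInf_sigma]
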